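/- Let $k$ be a commutative ring with $\tfrac12\in k$ and let $J$ be a unital (linear) Jordan $k$-algebra, i.e. a unital commutative nonassociative $k$-algebra with $(ab)a^2=a(ba^2)$. Write $L_a$ for the multiplication by $a$ and $U_a=2L_a^2-L_{a^2}$. Let $\mathbf J=(J^+,J^-)=(J,J)$ be its Jordan pair, with quadratic maps $Q_a=U_a$, triple products $\{abc\}=D(a,b)c=U_{a+c}b-U_ab-U_cb$, and $\delta(a,b)=(D(a,b),-D(b,a))\in\mathrm{End}_k(J^+)\times\mathrm{End}_k(J^-)$. Definitions. (1) $\mathfrak{instr}(\mathbf J)$ is the Lie algebra spanned by all $\delta(a,b)$. $\mathfrak{uider}(\mathbf J)=\mathbf J\diamond\mathbf J$ is the quotient of $J^+\otimes_k J^-$ by the submodule generated by all $\delta(x,y)(u\otimes v)+\delta(u,v)(x\otimes y)$ and $\delta(x,y)(x\otimes y)$, where $T(u\otimes v)=T^+u\otimes v+u\otimes T^-v$; the class of $a\otimes b$ is $a\diamond b$, and $\mathfrak{uider}(\mathbf J)$ is a Lie algebra with bracket $[x\diamond y,u\diamond v]=\delta(x,y)u\diamond v+u\diamond\delta(x,y)v$,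 where $\delta(x,y)u=D(x,y)u$ and $\delta(x,y)v=-D(y,x)v$. Let $\mathfrak{ud}_{JP}:\mathfrak{uider}(\mathbf J)\to\mathfrak{instr}(\mathbf J)$, $a\diamond b\mapsto\delta(a,b)$. (2) $L=\mathrm{TKK}(\mathbf J)=J^+\oplus\mathfrak{instr}(\mathbf J)\oplus J^-$ and $\mathfrak{u}\mathrm{TKK}(\mathbf J)=J^+\oplus\mathfrak{uider}(\mathbf J)\oplus J^-$ are the Tits-Kantor-Koecher and the universal Tits-Kantor-Koecher Lie algebras: the middle term is a subalgebra acting on $J^\pm$ (through $\mathfrak{ud}_{JP}$ in the second case), $[J^+,J^+]=[J^-,J^-]=0$, and for $a\in J^+$, $b\in J^-$ one has $[a,b]=\delta(a,b)$, respectively $[a,b]=a\diamond b$. Let $\widehat{\mathfrak{ud}}:\mathfrak{u}\mathrm{TKK}(\mathbf J)\to\mathrm{TKK}(\mathbf J)$ be the homomorphism that is the identity on $J^\pm$ and $\mathfrak{ud}_{JP}$ on $\mathfrak{uider}(\mathbf J)$. (3) $J*J$ is the quotient of $J\otimes_kJ$ by the submodule generated by all $a\otimes bc+b\otimes ca+c\otimes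 ab$ and $a\otimes b+b\otimes a$; the class of $a\otimes b$ is $a*b$. Let $\mathfrak{ud}_{JA}:J*J\to\mathrm{End}_k(J)$, $a*b\mapsto 2[L_a,L_b]$, and $\mathrm{HC}(J)=\{\sum a_i*b_i:\sum[L_{a_i},L_{b_i}]=0\}\subseteq J*J$. (4) For a Lie algebra $L$, $\mathfrak{uce}(L)$ is the quotient of $L\wedge L$ by the submodule generated by all $x\wedge[y,z]+y\wedge[z,x]+z\wedge[x,y]$; the class of $x\wedge y$ is $\langle x,y\rangle$, $u:\mathfrak{uce}(L)\to L$ is $\langle x,y\rangle\mapsto[x,y]$, and the bracket is $[X,Y]=\langle u(X),u(Y)\rangle$. A central extension is a surjective homomorphism $f:K\to L$ of Lie algebras with central kernel; it is a covering if $K=[K,K]$, and universal if for every central extension $g:E\to L$ there is a unique homomorphism $h:K\to E$ with $g\circ h=f$. Proposition. With $L=\mathrm{TKK}(\mathbf J)$, $$\ker(\mathfrak{ud}_{JP})=\mathrm{HC}(J)=\ker(\mathfrak{ud}_{JA})=\ker(u)$$ in the following sense. (i) $\mathrm{HC}(J)=\ker(\mathfrak{ud}_{JA})$. (ii) There is an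 injective linear map $\beta:J*J\to\mathbf J\diamond\mathbf J$ with $\beta(a*b)=a\diamond b-1\diamond ab$ for all $a,b\in J$, and $\beta(\mathrm{HC}(J))=\ker(\mathfrak{ud}_{JP})$. (iii) $u:\mathfrak{uce}(L)\to L$ and $\widehat{\mathfrak{ud}}:\mathfrak{u}\mathrm{TKK}(\mathbf J)\to L$ are both universal central extensions and coverings. There is an isomorphism of Lie algebras $\varphi:\mathfrak{uce}(L)\to\mathfrak{u}\mathrm{TKK}(\mathbf J)$ with $\widehat{\mathfrak{ud}}\circ\varphi=u$ and $\varphi(\langle a,b\rangle)=a\diamond b$ for $a\in J^+$, $b\in J^-$, and $\varphi(\ker u)=\ker(\widehat{\mathfrak{ud}})=\ker(\mathfrak{ud}_{JP})$. In particular $\mathfrak{u}\mathrm{TKK}(\mathbf J)$ is a universal covering of $\mathrm{TKK}(\mathbf J)$ whose kernel is identified by $\beta$ with $\{\sum a_i*b_i:\sum[L_{a_i},L_{b_i}]=0\}\subseteq J*J$. -/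

import Mathlib

open TensorProduct

universe u v v' w

noncomputable section

/-! ## Central extensions of Lie algebras and the Lie algebra `uce(L)` -/

namespace LieExt

section
variable {k : Type*} [CommRing k] {K L : Type*}
  [LieRing K] [LieAlgebra k K] [LieRing L] [LieAlgebra k L]

/-- A central extension: a surjective homomorphism with central kernel. -/
def IsCentralExtension (f : K →ₗ⁅k⁆ L) : Prop :=
  Function.Surjective f ∧ ∀ x : K, f x = 0 → ∀ y : K, ⁅x, y⁆ = 0

end

/-- A Lie algebra is perfect if it is spanned by its brackets. -/
def IsPerfect (k : Type*) [CommRing k] (L : Type*) [LieRing L] [LieAlgebra k L] : Prop :=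
  Submodule.span k {z : L | ∃ x y : L, z = ⁅x, y⁆} = ⊤

/-- A covering: a central extension `f : K → L` with `K` perfect. -/
def IsCovering {k : Type*} [CommRing k] {K L : Type*}
    [LieRing K] [LieAlgebra k K] [LieRing L] [LieAlgebra k L] (f : K →ₗ⁅k⁆ L) : Prop :=
  IsCentralExtension f ∧ IsPerfect k K

/-- A universal central extension: a central extension `f : K → L` such that for every central
extension `g : E → L` (with `E` in the universe `w`) there is exactly one homomorphism `h : K → E`
with `g ∘ h = f`. -/
def IsUniversalCentralExtension {k : Type u} [CommRing k] {K : Type v} {L : Type v'}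
    [LieRing K] [LieAlgebra k K] [LieRing L] [LieAlgebra k L] (f : K →ₗ⁅k⁆ L) : Prop :=
  IsCentralExtension f ∧
    ∀ (E : Type w) [LieRing E] [LieAlgebra k E] (g : E →ₗ⁅k⁆ L), IsCentralExtension g →
      ∃! h : K →ₗ⁅k⁆ E, ∀ x : K, g (h x) = f x

section uce
variable (k : Type*) [CommRing k] (L : Type*) [LieRing L] [LieAlgebra k L]

/-- The relations of `uce(L)`: the elements `x ⊗ x` (so that the quotient is one of the exterior
square of `L`) and the cyclic sums `x ∧ [y,z] + y ∧ [z,x] + z ∧ [x,y]`. -/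
def uceRel : Submodule k (L ⊗[k] L) :=
  Submodule.span k
    ({t | ∃ x : L, t = x ⊗ₜ[k] x} ∪
      {t | ∃ x y z : L, t = x ⊗ₜ[k] ⁅y, z⁆ + y ⊗ₜ[k] ⁅z, x⁆ + z ⊗ₜ[k] ⁅x, y⁆})

/-- `uce(L) = (L ∧ L) / ⟨x ∧ [y,z] + y ∧ [z,x] + z ∧ [x,y]⟩`. -/
def Uce : Type _ := (L ⊗[k] L) ⧸ uceRel k L

namespace Uce

instance : AddCommGroup (Uce k L) := inferInstanceAs (AddCommGroup ((L ⊗[k] L) ⧸ uceRel k L))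
instance : Module k (Uce k L) := inferInstanceAs (Module k ((L ⊗[k] L) ⧸ uceRel k L))

/-- The class `⟨x, y⟩` of `x ∧ y`, as a bilinear map. -/
def mk : L →ₗ[k] L →ₗ[k] Uce k L :=
  (TensorProduct.mk k L L).compr₂ ((uceRel k L).mkQ : L ⊗[k] L →ₗ[k] Uce k L)

variable {k L}

theorem mk_self (x : L) : mk k L x x = 0 :=
  (Submodule.Quotient.mk_eq_zero _).2 (Submodule.subset_span (Or.inl ⟨x, rfl⟩))

theorem mk_cyc (x y z : L) : mk k L x ⁅y, z⁆ + mk k L y ⁅z, x⁆ + mk k L z ⁅x, y⁆ = 0 :=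
  (Submodule.Quotient.mk_eq_zero _).2 (Submodule.subset_span (Or.inr ⟨x, y, z, rfl⟩))

theorem mk_skew (x y : L) : mk k L x y = - mk k L y x := by
  have h := mk_self (k := k) (x + y)
  simp only [map_add, LinearMap.add_apply, mk_self, zero_add, add_zero] at h
  rw [eq_neg_iff_add_eq_zero, add_comm]; exact h

theorem induction {p : Uce k L → Prop} (X : Uce k L) (h0 : p 0)
    (hm : ∀ x y, p (mk k L x y)) (ha : ∀ X Y, p X → p Y → p (X + Y)) : p X := by
  obtain ⟨t, rfl⟩ := Submodule.Quotient.mk_surjective _ X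
  induction t using TensorProduct.induction_on with
  | zero => exact h0
  | tmul x y => exact hm x y
  | add a b h1 h2 => exact ha _ _ h1 h2

variable (k L) in
/-- The linear map underlying `u : uce(L) → L`, `⟨x, y⟩ ↦ [x, y]`. -/
def uLin : Uce k L →ₗ[k] L :=
  (uceRel k L).liftQ (TensorProduct.lift (LieModule.toEnd k L L : L →ₗ[k] Module.End k L)) <| by
    rw [uceRel, Submodule.span_le]
    rintro t (⟨x, rfl⟩ | ⟨x, y, z, rfl⟩)
    · simp
    · simpa using lie_jacobi x y z

@[simp] theorem uLin_mk (x y : L) : uLin k L (mk k L x y) = ⁅x, y⁆ := rfl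

/-- The bracket of `uce(L)` is `[X, Y] = ⟨u(X), u(Y)⟩`. -/
instance : Bracket (Uce k L) (Uce k L) := ⟨fun X Y => mk k L (uLin k L X) (uLin k L Y)⟩

theorem lie_def (X Y : Uce k L) : ⁅X, Y⁆ = mk k L (uLin k L X) (uLin k L Y) := rfl

instance : LieRing (Uce k L) where
  add_lie X Y Z := by simp [lie_def]
  lie_add X Y Z := by simp [lie_def]
  lie_self X := by simp [lie_def, mk_self]
  leibniz_lie X Y Z := by
    simp only [lie_def, uLin_mk]
    have h := mk_cyc (k := k) (uLin k L X) (uLin k L Y) (uLin k L Z)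
    rw [mk_skew ⁅uLin k L X, uLin k L Y⁆, ← lie_skew (uLin k L X) (uLin k L Z), map_neg]
    rw [add_assoc, add_eq_zero_iff_eq_neg] at h
    rw [h]; abel

instance : LieAlgebra k (Uce k L) where
  lie_smul c X Y := by simp [lie_def]

variable (k L) in
/-- The homomorphism `u : uce(L) → L`, `⟨x, y⟩ ↦ [x, y]`. -/
def u : Uce k L →ₗ⁅k⁆ L :=
  { uLin k L with map_lie' := fun {_ _} => rfl }

end Uce

end uce

end LieExt

/-! ## Jordan algebras, their Jordan pairs, and Tits-Kantor-Koecher algebras -/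

namespace JordanTKK

/- Associative rings carry the commutator bracket. -/
attribute [local instance] LieRing.ofAssociativeRing

section Ops
variable (k : Type*) [CommRing k] (J : Type*) [NonAssocCommRing J] [Module k J]
  [IsScalarTower k J J] [SMulCommClass k J J]

variable {J} in
/-- The left multiplication `L_a`. -/
abbrev L (a : J) : Module.End k J := LinearMap.mulLeft k a

variable {J} in
/-- The quadratic operator `U_a = 2 L_a² - L_{a²}` of a linear Jordan algebra. The Jordan pair of
`J` is `(J, J)` with quadratic maps `Q_a = U_a` on both sides. -/
def U (a : J) : Module.End k J := 2 • (L k a * L k a) - L k (a * a)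

variable {J} in
/-- The linearized product `{x y z} = Q_{x,z} y = Q_{x+z} y - Q_x y - Q_z y` of the pair. -/
def triple (x y z : J) : J := U k (x + z) y - U k x y - U k z y

variable {J} in
theorem triple_eq (x y z : J) :
    triple k x y z = 2 • (x * (y * z) + z * (y * x) - y * (x * z)) := by
  simp only [triple, U, L, LinearMap.sub_apply, LinearMap.smul_apply, Module.End.mul_apply,
    LinearMap.mulLeft_apply, mul_comm _ y, add_mul, mul_add, mul_comm z x]
  abel

/-- `D(x, y) z = {x y z}`, as a bilinear map into the endomorphisms of `J`. -/
def D : J →ₗ[k] J →ₗ[k] Module.End k J :=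
  LinearMap.mk₂ k
    (fun x y =>
      { toFun := fun z => triple k x y z
        map_add' := fun a b => by simp only [triple_eq, mul_add, add_mul]; abel
        map_smul' := fun c a => by
          simp only [triple_eq, mul_smul_comm, smul_mul_assoc, RingHom.id_apply, smul_comm c 2,
            smul_add, smul_sub] })
    (fun a b y => by ext z; simp only [triple_eq, mul_add, add_mul, LinearMap.coe_mk,
      AddHom.coe_mk, LinearMap.add_apply]; abel)
    (fun c a y => by
      ext z
      simp only [triple_eq, mul_smul_comm, smul_mul_assoc, smul_comm c 2, LinearMap.coe_mk,
        AddHom.coe_mk, LinearMap.smul_apply, smul_add, smul_sub])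
    (fun x a b => by ext z; simp only [triple_eq, mul_add, add_mul, LinearMap.coe_mk,
      AddHom.coe_mk, LinearMap.add_apply]; abel)
    (fun c x a => by
      ext z
      simp only [triple_eq, mul_smul_comm, smul_mul_assoc, smul_comm c 2, LinearMap.coe_mk,
        AddHom.coe_mk, LinearMap.smul_apply, smul_add, smul_sub])

/-- `δ(x, y) = (D(x, y), -D(y, x))`, an endomorphism of the pair of modules `(J⁺, J⁻) = (J, J)`. -/
def delta : J →ₗ[k] J →ₗ[k] (Module.End k J × Module.End k J) :=
  LinearMap.mk₂ k (fun x y => (D k J x y, - D k J y x))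
    (by intros; ext <;> simp; abel) (by intros; ext <;> simp)
    (by intros; ext <;> simp; abel) (by intros; ext <;> simp)

/-- The action `T.(u ⊗ v) = T⁺u ⊗ v + u ⊗ T⁻v` of `T = (T⁺, T⁻)` on `J⁺ ⊗ J⁻`. -/
def tact : (Module.End k J × Module.End k J) →ₗ[k] Module.End k (J ⊗[k] J) where
  toFun T := TensorProduct.map T.1 LinearMap.id + TensorProduct.map LinearMap.id T.2
  map_add' S T := by ext u v; simp [TensorProduct.add_tmul, TensorProduct.tmul_add]; abel
  map_smul' c T := by ext u v; simp [TensorProduct.smul_tmul']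

/-- The submodule `I` generated by the elements `δ(x,y)(u ⊗ v) + δ(u,v)(x ⊗ y)` and
`δ(x,y)(x ⊗ y)`. -/
def uiderRel : Submodule k (J ⊗[k] J) :=
  Submodule.span k
    ({t | ∃ x y u v : J, t = tact k J (delta k J x y) (u ⊗ₜ[k] v) +
        tact k J (delta k J u v) (x ⊗ₜ[k] y)} ∪
      {t | ∃ x y : J, t = tact k J (delta k J x y) (x ⊗ₜ[k] y)})

/-- The universal inner derivation algebra `uider(𝐉) = 𝐉 ⋄ 𝐉 = (J⁺ ⊗ J⁻)/I` of the Jordan pair. -/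
def UIder : Type _ := (J ⊗[k] J) ⧸ uiderRel k J

instance : AddCommGroup (UIder k J) := inferInstanceAs (AddCommGroup ((J ⊗[k] J) ⧸ uiderRel k J))
instance : Module k (UIder k J) := inferInstanceAs (Module k ((J ⊗[k] J) ⧸ uiderRel k J))

/-- The class `a ⋄ b` of `a ⊗ b`, as a bilinear map. -/
def diamond : J →ₗ[k] J →ₗ[k] UIder k J :=
  (TensorProduct.mk k J J).compr₂ ((uiderRel k J).mkQ : J ⊗[k] J →ₗ[k] UIder k J)

/-- The relations of `J * J`: `a ⊗ bc + b ⊗ ca + c ⊗ ab` and `a ⊗ b + b ⊗ a`. -/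
def starRel : Submodule k (J ⊗[k] J) :=
  Submodule.span k
    ({t | ∃ a b c : J, t = a ⊗ₜ[k] (b * c) + b ⊗ₜ[k] (c * a) + c ⊗ₜ[k] (a * b)} ∪
      {t | ∃ a b : J, t = a ⊗ₜ[k] b + b ⊗ₜ[k] a})

/-- The module `J * J` (also written `uider_JA(J)`). -/
abbrev JStar : Type _ := (J ⊗[k] J) ⧸ starRel k J

variable {J} in
/-- The class `a * b` of `a ⊗ b` in `J * J`. -/
def star (a b : J) : JStar k J := Submodule.Quotient.mk (a ⊗ₜ[k] b)

/-- `HC(J) = {∑ aᵢ * bᵢ : ∑ [L_{aᵢ}, L_{bᵢ}] = 0}`, as a subset of `J * J`. -/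
def HC : Set (JStar k J) :=
  {t | ∃ (n : ℕ) (a b : Fin n → J),
    t = ∑ i, star k (a i) (b i) ∧ ∑ i, ⁅L k (a i), L k (b i)⁆ = 0}

end Ops

section Identities
variable {J : Type*} [NonAssocCommRing J] [IsCommJordan J]

theorem jordan_lin {k : Type*} [CommRing k] [Invertible (2 : k)] [Module k J] (a b c x : J) :
    a * ((b * c) * x) - (b * c) * (a * x) + (b * ((c * a) * x) - (c * a) * (b * x))
      + (c * ((a * b) * x) - (a * b) * (c * x)) = 0 := by
  have h := congrArg (fun f : AddMonoid.End J => f x) (two_nsmul_lie_lmul_lmul_add_add_eq_zero a b c)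
  have h2 : (2 : k) • (a * ((b * c) * x) - (b * c) * (a * x) +
      (b * ((c * a) * x) - (c * a) * (b * x)) + (c * ((a * b) * x) - (a * b) * (c * x))) = 0 := by
    rw [two_smul, ← two_nsmul]; exact h
  have h3 := congrArg (fun y => (⅟2 : k) • y) h2
  simpa [smul_smul] using h3

/-- `[L_a, L_b]` is a derivation. -/
theorem jordan_der {k : Type*} [CommRing k] [Invertible (2 : k)] [Module k J] (a b c x : J) :
    a * (b * (c * x)) - b * (a * (c * x)) =
      (a * (b * c) - b * (a * c)) * x + c * (a * (b * x) - b * (a * x)) := by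
  have h1 := jordan_lin (k := k) b c x a
  have h3 := jordan_lin (k := k) a c x b
  simp only [mul_sub, sub_mul, mul_comm] at h1 h3 ⊢
  linear_combination (norm := abel) h3 - h1

end Identities

section LieAlg
variable (k : Type*) [CommRing k] (J : Type*) [NonAssocCommRing J]
  [Module k J] [IsScalarTower k J J] [SMulCommClass k J J]

variable {k J} in
@[simp] theorem D_apply (x y z : J) :
    D k J x y z = 2 • (x * (y * z) + z * (y * x) - y * (x * z)) := triple_eq k x y z

variable {k J} in
@[simp] theorem delta_apply (x y : J) : delta k J x y = (D k J x y, -D k J y x) := rfl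

variable [Invertible (2 : k)] [IsCommJordan J]

variable {k J} in
theorem D_five (a b c d e : J) :
    D k J a b (D k J c d e) - D k J c d (D k J a b e) =
      D k J (D k J a b c) d e - D k J c (D k J b a d) e := by
  have h1 := jordan_der (k := k) a b c (d * e)
  have h2 := jordan_der (k := k) a b d (c * e)
  have h3 := congrArg (fun z => c * z) (jordan_der (k := k) a b d e)
  have h4 := congrArg (fun z => d * z) (jordan_der (k := k) a b c e)
  have h5 := jordan_der (k := k) a b (c * d) e
  have h6 := congrArg (fun z => z * e) (jordan_der (k := k) a b c d)
  have h7 := jordan_der (k := k) c d (a * b) e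
  have h8 := jordan_lin (k := k) (a * b) c d e
  simp only [D_apply, two_smul, mul_sub, mul_add, sub_mul, add_mul, mul_comm]
    at h1 h2 h3 h4 h5 h6 h7 h8 ⊢
  linear_combination (norm := abel_nf) (4 : ℤ) • (h1 - h2 + h3 - h4 + h5 + h6 - h7 + h8)

variable {k J} in
theorem delta_lie (a b c d : J) :
    ⁅delta k J a b, delta k J c d⁆ =
      delta k J ((delta k J a b).1 c) d + delta k J c ((delta k J a b).2 d) := by
  ext e
  · have := D_five (k := k) a b c d e
    simpa [Ring.lie_def, sub_eq_add_neg] using this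
  · have := D_five (k := k) b a d c e
    simp only [delta_apply, Ring.lie_def, Module.End.mul_apply, Prod.snd_sub, Prod.snd_mul,
      LinearMap.sub_apply, LinearMap.neg_apply, map_neg, neg_neg, Prod.snd_add,
      LinearMap.add_apply, Prod.snd_neg] at this ⊢
    rw [this]; abel

/-- The submodule of `End(J⁺) × End(J⁻)` spanned by the `δ(a, b)`. -/
def instrSub : Submodule k (Module.End k J × Module.End k J) :=
  Submodule.span k {T | ∃ a b : J, T = delta k J a b}

variable {k J} in
theorem lie_delta {T : Module.End k J × Module.End k J} (hT : T ∈ instrSub k J) (c d : J) :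
    ⁅T, delta k J c d⁆ = delta k J (T.1 c) d + delta k J c (T.2 d) := by
  induction hT using Submodule.span_induction with
  | mem T h => obtain ⟨a, b, rfl⟩ := h; exact delta_lie a b c d
  | zero => simp only [Ring.lie_def, zero_mul, mul_zero, Prod.fst_zero, Prod.snd_zero,
      LinearMap.zero_apply, map_zero, sub_self, add_zero]
  | add S T _ _ hS hT =>
    rw [add_lie, hS, hT]; simp only [Prod.fst_add, Prod.snd_add, LinearMap.add_apply, map_add]; abel
  | smul r T _ hT =>
    rw [smul_lie, hT]
    simp only [Prod.smul_fst, Prod.smul_snd, LinearMap.smul_apply, map_smul, smul_add]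

/-- The inner derivation algebra `instr(𝐉)`, a Lie algebra of endomorphisms of `(J⁺, J⁻)`. -/
def instr : LieSubalgebra k (Module.End k J × Module.End k J) :=
  { instrSub k J with
    lie_mem' := by
      intro S T hS hT
      change T ∈ instrSub k J at hT
      change ⁅S, T⁆ ∈ instrSub k J
      induction hT using Submodule.span_induction with
      | mem T h =>
        obtain ⟨c, d, rfl⟩ := h
        rw [lie_delta hS]
        exact add_mem (Submodule.subset_span ⟨_, _, rfl⟩) (Submodule.subset_span ⟨_, _, rfl⟩)
      | zero => simp
      | add A B _ _ hA hB => rw [lie_add]; exact add_mem hA hB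
      | smul r A _ hA => rw [lie_smul]; exact Submodule.smul_mem _ _ hA }

instance : LieRing (instr k J) := inferInstance
instance : LieAlgebra k (instr k J) := inferInstance

variable {k J} in
theorem delta_mem (a b : J) : delta k J a b ∈ instr k J :=
  Submodule.subset_span ⟨a, b, rfl⟩

variable {k J} in
@[simp] theorem tact_tmul (T : Module.End k J × Module.End k J) (u v : J) :
    tact k J T (u ⊗ₜ[k] v) = T.1 u ⊗ₜ[k] v + u ⊗ₜ[k] T.2 v := rfl

variable {k J} in
theorem tact_lie (S T : Module.End k J × Module.End k J) :
    tact k J ⁅S, T⁆ = ⁅tact k J S, tact k J T⁆ := by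
  ext u v
  simp [Ring.lie_def, TensorProduct.sub_tmul, TensorProduct.tmul_sub]
  abel

variable {k J} in
theorem tact_comm (T : Module.End k J × Module.End k J) (hT : T ∈ instr k J) (a b : J)
    (t : J ⊗[k] J) :
    tact k J T (tact k J (delta k J a b) t) = tact k J (delta k J a b) (tact k J T t)
      + tact k J (delta k J (T.1 a) b) t + tact k J (delta k J a (T.2 b)) t := by
  have h := congrArg (fun f => f t) (tact_lie T (delta k J a b))
  simp only [lie_delta hT, map_add, LinearMap.add_apply, Ring.lie_def, LinearMap.sub_apply,
    Module.End.mul_apply] at h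
  rw [add_assoc, h]; abel

variable {k J} in
theorem tact_rel (T : Module.End k J × Module.End k J) (hT : T ∈ instr k J) :
    uiderRel k J ≤ (uiderRel k J).comap (tact k J T) := by
  have A : ∀ x y u v : J, tact k J (delta k J x y) (u ⊗ₜ[k] v) +
        tact k J (delta k J u v) (x ⊗ₜ[k] y) ∈ uiderRel k J :=
    fun x y u v => Submodule.subset_span (Or.inl ⟨x, y, u, v, rfl⟩)
  conv_lhs => rw [uiderRel]
  rw [Submodule.span_le]
  rintro t (⟨x, y, u, v, rfl⟩ | ⟨x, y, rfl⟩)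
  · simp only [SetLike.mem_coe, Submodule.mem_comap, map_add, tact_comm T hT]
    rw [tact_tmul T, tact_tmul T, map_add, map_add]
    convert add_mem (add_mem (A x y (T.1 u) v) (A x y u (T.2 v)))
      (add_mem (A (T.1 x) y u v) (A x (T.2 y) u v)) using 1
    abel
  · simp only [SetLike.mem_coe, Submodule.mem_comap, tact_comm T hT]
    rw [tact_tmul T, map_add]
    convert add_mem (A x y (T.1 x) y) (A x y x (T.2 y)) using 1
    abel

/-- The action of `instr(𝐉)` on `uider(𝐉)`: `T.(u ⋄ v) = T⁺u ⋄ v + u ⋄ T⁻v`. -/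
def act : instr k J →ₗ[k] Module.End k (UIder k J) where
  toFun T := (uiderRel k J).mapQ (uiderRel k J) (tact k J T.1) (tact_rel T.1 T.2)
  map_add' S T := by
    refine Submodule.linearMap_qext _ ?_
    ext u v
    exact congrArg (uiderRel k J).mkQ (by simp)
  map_smul' c T := by
    refine Submodule.linearMap_qext _ ?_
    ext u v
    exact congrArg (uiderRel k J).mkQ (by simp)

namespace UIder

variable {k J} in
theorem induction {p : UIder k J → Prop} (X : UIder k J) (h0 : p 0)
    (hm : ∀ x y, p (diamond k J x y)) (ha : ∀ X Y, p X → p Y → p (X + Y)) : p X := by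
  obtain ⟨t, rfl⟩ := Submodule.Quotient.mk_surjective _ X
  induction t using TensorProduct.induction_on with
  | zero => exact h0
  | tmul x y => exact hm x y
  | add a b h1 h2 => exact ha _ _ h1 h2

variable {k J} in
@[simp] theorem act_diamond (T : instr k J) (u v : J) :
    act k J T (diamond k J u v) = diamond k J (T.1.1 u) v + diamond k J u (T.1.2 v) := rfl

/-- `δ` as a bilinear map into `instr(𝐉)`. -/
def deltaI : J →ₗ[k] J →ₗ[k] instr k J :=
  LinearMap.mk₂ k (fun a b => ⟨delta k J a b, delta_mem a b⟩)
    (by intros; ext1; simp only [map_add, LinearMap.add_apply]; rfl)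
    (by intros; ext1; simp only [map_smul, LinearMap.smul_apply]; rfl)
    (by intros; ext1; simp only [map_add]; rfl)
    (by intros; ext1; simp only [map_smul]; rfl)

variable {k J} in
@[simp] theorem deltaI_coe (a b : J) :
    (deltaI k J a b : Module.End k J × Module.End k J) = delta k J a b := rfl

/-- The linear map underlying `ud_JP : uider(𝐉) → instr(𝐉)`, `a ⋄ b ↦ δ(a, b)`. -/
def udLin : UIder k J →ₗ[k] instr k J :=
  (uiderRel k J).liftQ (TensorProduct.lift (deltaI k J)) <| by
    rw [uiderRel, Submodule.span_le]
    have B : ∀ x y u v : J,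
        (TensorProduct.lift (deltaI k J) (tact k J (delta k J x y) (u ⊗ₜ[k] v)) : instr k J) =
          ⁅deltaI k J x y, deltaI k J u v⁆ := by
      intro x y u v
      ext1
      rw [tact_tmul, map_add, TensorProduct.lift.tmul, TensorProduct.lift.tmul]
      exact (delta_lie x y u v).symm
    rintro t (⟨x, y, u, v, rfl⟩ | ⟨x, y, rfl⟩)
    · rw [SetLike.mem_coe, LinearMap.mem_ker, map_add, B, B, ← lie_skew, neg_add_cancel]
    · rw [SetLike.mem_coe, LinearMap.mem_ker, B, lie_self]

variable {k J} in
@[simp] theorem udLin_diamond (a b : J) : udLin k J (diamond k J a b) = deltaI k J a b := rfl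

/-- The bracket of `uider(𝐉)`: `[x ⋄ y, u ⋄ v] = δ(x,y)u ⋄ v + u ⋄ δ(x,y)v`. -/
instance : Bracket (UIder k J) (UIder k J) := ⟨fun X Y => act k J (udLin k J X) Y⟩

variable {k J} in
theorem lie_def' (X Y : UIder k J) : ⁅X, Y⁆ = act k J (udLin k J X) Y := rfl

variable {k J} in
theorem ud_act (T : instr k J) (Y : UIder k J) : udLin k J (act k J T Y) = ⁅T, udLin k J Y⁆ := by
  induction Y using UIder.induction with
  | h0 => simp
  | hm u v =>
    ext1
    rw [act_diamond, map_add]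
    exact (lie_delta T.2 u v).symm
  | ha X Y hX hY => rw [map_add, map_add, hX, hY, map_add, lie_add]

variable {k J} in
theorem act_lie (S T : instr k J) (Y : UIder k J) :
    act k J ⁅S, T⁆ Y = act k J S (act k J T Y) - act k J T (act k J S Y) := by
  induction Y using UIder.induction with
  | h0 => simp
  | hm u v =>
    simp only [act_diamond, map_add, LieSubalgebra.coe_bracket, Ring.lie_def, Prod.fst_sub, Prod.snd_sub,
      Prod.fst_mul, Prod.snd_mul, LinearMap.sub_apply, Module.End.mul_apply, map_sub]
    abel
  | ha X Y hX hY => simp only [map_add, hX, hY]; abel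

variable {k J} in
theorem skew' (X Y : UIder k J) : ⁅X, Y⁆ + ⁅Y, X⁆ = 0 := by
  simp only [lie_def']
  induction X using UIder.induction with
  | h0 => simp
  | ha X X' hX hX' =>
    simp only [map_add, LinearMap.add_apply]
    rw [add_add_add_comm, hX, hX', add_zero]
  | hm x y =>
    induction Y using UIder.induction with
    | h0 => simp
    | ha X X' hX hX' =>
      simp only [map_add, LinearMap.add_apply]
      rw [add_add_add_comm, hX, hX', add_zero]
    | hm u v =>
      exact (Submodule.Quotient.mk_eq_zero _).2
        (Submodule.subset_span (Or.inl ⟨x, y, u, v, rfl⟩))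

variable {k J} in
theorem self' (X : UIder k J) : ⁅X, X⁆ = 0 := by
  induction X using UIder.induction with
  | h0 => simp [lie_def']
  | hm x y =>
    exact (Submodule.Quotient.mk_eq_zero _).2 (Submodule.subset_span (Or.inr ⟨x, y, rfl⟩))
  | ha X Y hX hY =>
    have h := skew' X Y
    simp only [lie_def'] at hX hY h ⊢
    simp only [map_add, LinearMap.add_apply, hX, hY, zero_add, add_zero]
    rw [add_comm]; exact h

instance : LieRing (UIder k J) where
  add_lie X Y Z := by simp [lie_def']
  lie_add X Y Z := by simp [lie_def']
  lie_self := self'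
  leibniz_lie X Y Z := by
    simp only [lie_def', ud_act, act_lie]; abel

instance : LieAlgebra k (UIder k J) where
  lie_smul c X Y := by simp [lie_def']

end UIder

/-- `ud_JP : uider(𝐉) → instr(𝐉)`, `a ⋄ b ↦ δ(a, b)`. -/
def udJP : UIder k J →ₗ⁅k⁆ instr k J :=
  { UIder.udLin k J with map_lie' := fun {_ Y} => UIder.ud_act _ Y }

theorem udJP_surjective : Function.Surjective (udJP k J) := by
  rintro ⟨T, hT⟩
  change T ∈ Submodule.span k _ at hT
  have : T ∈ LinearMap.range ((instr k J).toSubmodule.subtype ∘ₗ UIder.udLin k J) := by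
    refine Submodule.span_le.2 ?_ hT
    rintro _ ⟨a, b, rfl⟩
    exact ⟨diamond k J a b, rfl⟩
  obtain ⟨X, hX⟩ := this
  exact ⟨X, Subtype.ext hX⟩

/-- The bilinear map `(a, b) ↦ 2 [L_a, L_b]`. -/
def twoComm : J →ₗ[k] J →ₗ[k] Module.End k J :=
  LinearMap.mk₂ k (fun a b => (2 : k) • ⁅L k a, L k b⁆)
    (by intros; ext; simp [Ring.lie_def, add_mul, mul_add]; module)
    (by intros; ext; simp [Ring.lie_def, smul_sub, smul_comm _ (2 : k), smul_mul_assoc,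
      mul_smul_comm])
    (by intros; ext; simp [Ring.lie_def, add_mul, mul_add]; module)
    (by intros; ext; simp [Ring.lie_def, smul_sub, smul_comm _ (2 : k), smul_mul_assoc,
      mul_smul_comm])

/-- `ud_JA : J * J → End(J)`, `a * b ↦ 2 [L_a, L_b]` (with image the inner derivations of `J`). -/
def udJA : JStar k J →ₗ[k] Module.End k J :=
  (starRel k J).liftQ (TensorProduct.lift (twoComm k J)) <| by
    rw [starRel, Submodule.span_le]
    rintro t (⟨a, b, c, rfl⟩ | ⟨a, b, rfl⟩)
    · ext x
      have h := congrArg (fun z => (2 : k) • z) (jordan_lin (k := k) a b c x)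
      simpa [twoComm, Ring.lie_def, smul_add] using h
    · ext x
      simp [twoComm, Ring.lie_def, ← smul_add]

section LHat
variable {k J} {D₀ : Type*} [LieRing D₀] [LieAlgebra k D₀]

/-- For Lie algebra homomorphisms `f : uider(𝐉) → D₀` (surjective) and `g : D₀ → instr(𝐉)` with
`g ∘ f = ud_JP`, the Lie algebra `J⁺ ⊕ D₀ ⊕ J⁻`. -/
@[ext, nolint unusedArguments]
structure LHat (f : UIder k J →ₗ⁅k⁆ D₀) (g : D₀ →ₗ⁅k⁆ instr k J)
    (hf : Function.Surjective f) (hg : ∀ X, g (f X) = udJP k J X) where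
  /-- The component in `J⁺`. -/
  pos : J
  /-- The component in `D₀`. -/
  mid : D₀
  /-- The component in `J⁻`. -/
  neg : J

variable {f : UIder k J →ₗ⁅k⁆ D₀} {g : D₀ →ₗ⁅k⁆ instr k J}
    {hf : Function.Surjective f} {hg : ∀ X, g (f X) = udJP k J X}

namespace LHat

/-- The underlying direct sum of modules. -/
def equivProd : LHat f g hf hg ≃ J × D₀ × J where
  toFun p := (p.pos, p.mid, p.neg)
  invFun p := ⟨p.1, p.2.1, p.2.2⟩
  left_inv _ := rfl
  right_inv _ := rfl

instance : AddCommGroup (LHat f g hf hg) := equivProd.addCommGroup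
instance : Module k (LHat f g hf hg) := equivProd.module k

/-- The bracket: `[X, a] = g(X)⁺ a` and `[X, b] = g(X)⁻ b` for `X` in `D₀`, `a` in `J⁺`, `b` in
`J⁻`, `[a, b] = f(a ⋄ b) = -[b, a]`, `[J⁺, J⁺] = [J⁻, J⁻] = 0`, and the bracket of `D₀`. -/
instance : Bracket (LHat f g hf hg) (LHat f g hf hg) :=
  ⟨fun p q =>
    { pos := (g p.mid).1.1 q.pos - (g q.mid).1.1 p.pos
      mid := ⁅p.mid, q.mid⁆ + f (diamond k J p.pos q.neg) - f (diamond k J q.pos p.neg)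
      neg := (g p.mid).1.2 q.neg - (g q.mid).1.2 p.neg }⟩

@[simp] theorem lie_pos (p q : LHat f g hf hg) :
    ⁅p, q⁆.pos = (g p.mid).1.1 q.pos - (g q.mid).1.1 p.pos := rfl
@[simp] theorem lie_mid (p q : LHat f g hf hg) : ⁅p, q⁆.mid =
    ⁅p.mid, q.mid⁆ + f (diamond k J p.pos q.neg) - f (diamond k J q.pos p.neg) := rfl
@[simp] theorem lie_neg' (p q : LHat f g hf hg) :
    ⁅p, q⁆.neg = (g p.mid).1.2 q.neg - (g q.mid).1.2 p.neg := rfl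

@[simp] theorem add_pos (p q : LHat f g hf hg) : (p + q).pos = p.pos + q.pos := rfl
@[simp] theorem add_mid (p q : LHat f g hf hg) : (p + q).mid = p.mid + q.mid := rfl
@[simp] theorem add_neg (p q : LHat f g hf hg) : (p + q).neg = p.neg + q.neg := rfl
@[simp] theorem zero_pos : (0 : LHat f g hf hg).pos = 0 := rfl
@[simp] theorem zero_mid : (0 : LHat f g hf hg).mid = 0 := rfl
@[simp] theorem zero_neg : (0 : LHat f g hf hg).neg = 0 := rfl
@[simp] theorem smul_pos (c : k) (p : LHat f g hf hg) : (c • p).pos = c • p.pos := rfl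
@[simp] theorem smul_mid (c : k) (p : LHat f g hf hg) : (c • p).mid = c • p.mid := rfl
@[simp] theorem smul_neg (c : k) (p : LHat f g hf hg) : (c • p).neg = c • p.neg := rfl

theorem lie_f (hf : Function.Surjective f) (hg : ∀ X, g (f X) = udJP k J X) (X : D₀) (a b : J) :
    ⁅X, f (diamond k J a b)⁆ =
      f (diamond k J ((g X).1.1 a) b) + f (diamond k J a ((g X).1.2 b)) := by
  obtain ⟨Y, rfl⟩ := hf X
  rw [← LieHom.map_lie, hg, ← map_add]
  rfl

theorem g_f (hg : ∀ X, g (f X) = udJP k J X) (a b : J) :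
    (g (f (diamond k J a b))).1 = delta k J a b := by
  rw [hg]; rfl

theorem triple_comm (a b c : J) : D k J a b c = D k J c b a := by
  simp only [D_apply, mul_comm a c]; abel_nf

theorem i_add (S T : instr k J) : (S + T).1 = S.1 + T.1 := rfl
theorem i_sub (S T : instr k J) : (S - T).1 = S.1 - T.1 := rfl
theorem i_smul (c : k) (T : instr k J) : (c • T).1 = c • T.1 := rfl
theorem i_lie (S T : instr k J) : ⁅S, T⁆.1 = S.1 * T.1 - T.1 * S.1 := rfl

instance : LieRing (LHat f g hf hg) where
  add_lie p q r := by
    ext <;> simp only [lie_pos, lie_mid, lie_neg', add_pos, add_mid, add_neg, map_add, add_lie,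
      LinearMap.add_apply, i_add, Prod.fst_add, Prod.snd_add] <;> abel
  lie_add p q r := by
    ext <;> simp only [lie_pos, lie_mid, lie_neg', add_pos, add_mid, add_neg, map_add, lie_add,
      LinearMap.add_apply, i_add, Prod.fst_add, Prod.snd_add] <;> abel
  lie_self p := by ext <;> simp
  leibniz_lie p q r := by
    ext
    · simp only [lie_pos, lie_mid, lie_neg', add_pos, map_add, map_sub, LieHom.map_lie, i_add,
        i_sub, i_lie, Prod.fst_sub, Prod.fst_mul, Prod.fst_add, LinearMap.sub_apply,
        LinearMap.add_apply, Module.End.mul_apply, g_f hg, delta_apply]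
      rw [triple_comm p.pos r.neg q.pos, triple_comm r.pos q.neg p.pos,
        triple_comm r.pos p.neg q.pos]
      abel
    · have e : ∀ (x y : J) (X : D₀), ⁅f (diamond k J x y), X⁆ =
          -(f (diamond k J ((g X).1.1 x) y) + f (diamond k J x ((g X).1.2 y))) := by
        intro x y X
        rw [← lie_skew, lie_f hf hg]
      simp only [lie_pos, lie_mid, lie_neg', add_mid, map_add, map_sub, lie_add, lie_sub, add_lie,
        sub_lie, LinearMap.sub_apply, lie_f hf hg, e]
      rw [leibniz_lie p.mid q.mid r.mid]
      abel
    · simp only [lie_pos, lie_mid, lie_neg', add_neg, map_add, map_sub, LieHom.map_lie, i_add,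
        i_sub, i_lie, Prod.snd_sub, Prod.snd_mul, Prod.snd_add, LinearMap.sub_apply,
        LinearMap.add_apply, LinearMap.neg_apply, Module.End.mul_apply, g_f hg, delta_apply]
      rw [triple_comm p.neg r.pos q.neg, triple_comm r.neg q.pos p.neg,
        triple_comm r.neg p.pos q.neg]
      abel

instance : LieAlgebra k (LHat f g hf hg) where
  lie_smul c p q := by
    ext <;> simp only [lie_pos, lie_mid, lie_neg', smul_pos, smul_mid, smul_neg, map_smul,
      lie_smul, LinearMap.smul_apply, i_smul, Prod.smul_fst, Prod.smul_snd, smul_sub, smul_add]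

end LHat
end LHat

theorem id_surjective : Function.Surjective (LieHom.id : UIder k J →ₗ⁅k⁆ UIder k J) :=
  fun X => ⟨X, rfl⟩

theorem udJP_id (X : UIder k J) :
    udJP k J ((LieHom.id : UIder k J →ₗ⁅k⁆ UIder k J) X) = udJP k J X := rfl

theorem id_udJP (X : UIder k J) :
    (LieHom.id : instr k J →ₗ⁅k⁆ instr k J) (udJP k J X) = udJP k J X := rfl

/-- The Tits-Kantor-Koecher algebra `TKK(𝐉) = J⁺ ⊕ instr(𝐉) ⊕ J⁻`. -/
abbrev TKK : Type _ :=
  LHat (udJP k J) (LieHom.id : instr k J →ₗ⁅k⁆ instr k J) (udJP_surjective k J)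
    (id_udJP k J)

/-- The universal Tits-Kantor-Koecher algebra `uTKK(𝐉) = J⁺ ⊕ uider(𝐉) ⊕ J⁻`. -/
abbrev UTKK : Type _ :=
  LHat (LieHom.id : UIder k J →ₗ⁅k⁆ UIder k J) (udJP k J) (id_surjective k J)
    (udJP_id k J)

/-- The homomorphism `uTKK(𝐉) → TKK(𝐉)`, the identity on `J⁺` and `J⁻` and `ud_JP` on
`uider(𝐉)`. -/
def udHat : UTKK k J →ₗ⁅k⁆ TKK k J where
  toFun p := ⟨p.pos, udJP k J p.mid, p.neg⟩
  map_add' p q := LHat.ext rfl (map_add (udJP k J) _ _) rfl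
  map_smul' c p := LHat.ext rfl (map_smul (udJP k J) _ _) rfl
  map_lie' := by
    intro p q
    ext1
    · rfl
    · simp only [LHat.lie_mid, map_add, map_sub, LieHom.map_lie]
      rfl
    · rfl

/-- The inclusion of `uider(𝐉)` into `uTKK(𝐉)`. -/
def inc : UIder k J →ₗ[k] UTKK k J where
  toFun X := ⟨0, X, 0⟩
  map_add' _ _ := LHat.ext (add_zero 0).symm rfl (add_zero 0).symm
  map_smul' c _ := LHat.ext (smul_zero c).symm rfl (smul_zero c).symm

variable {J} in
/-- The element `a` of `J⁺ ⊆ TKK(𝐉)`. -/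
def inPos (a : J) : TKK k J := ⟨a, 0, 0⟩

variable {J} in
/-- The element `b` of `J⁻ ⊆ TKK(𝐉)`. -/
def inNeg (b : J) : TKK k J := ⟨0, 0, b⟩

end LieAlg

end JordanTKK

end

/-! In a central extension `g : E → L` a bracket depends only on the images of its arguments in `L`.
Hence `⟨g x, g y⟩ ↦ [x, y]` is a homomorphism from `uce(L)` to `E` over `L`, and two homomorphisms
over `L` from a perfect algebra to `E` agree. So a covering of a perfect `L` that admits a
homomorphism to `uce(L)` over `L` is universal and isomorphic to `uce(L)`. It remains to find such a
homomorphism for `uTKK → TKK`. Let `η = ½ δ(1,1)`, which acts as `±1` on `J^±` and kills `instr`.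
Since `⟨x, ·⟩` obeys the Leibniz rule (`Uce.mk_lie`), counting `η`-weights gives `⟨J^±, J^±⟩ = 0`
and expresses `⟨T, a⟩` through `⟨η, Ta⟩`. The relations of `uider` become the alternating law of
`⟨·,·⟩` on `instr`, so `a ⋄ b ↦ ⟨a, b⟩` is well defined, and it extends to `uTKK` by `a ↦ ⟨η, a⟩`
and `b ↦ -⟨η, b⟩`. For the kernel, `β : a * b ↦ a ⋄ b - 1 ⋄ ab` has the left inverse `ρ : a ⋄ b ↦ a
* b`, and `X - β(ρ X) = ½ (1 ⋄ ud_JP(X)⁺1)`. Thus `ker ud_JP` lies in the image of `β`, where `ud_JP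
∘ β = (ud_JA, ud_JA)`. The identities are `starMk_rel`, `diamond_cyc` and `uiderOfStar_starOfUIder`.
-/

namespace LieExt

/-! ### Central extensions and the universal property of `uce(L)` -/

section
variable {k : Type*} [CommRing k] {K L E : Type*} [LieRing K] [LieAlgebra k K]
  [LieRing L] [LieAlgebra k L] [LieRing E] [LieAlgebra k E]

/-- Brackets in the source of a central extension depend only on the images. -/
theorem IsCentralExtension.lie_congr {g : E →ₗ⁅k⁆ L} (hg : IsCentralExtension g)
    {x x' y y' : E} (hx : g x = g x') (hy : g y = g y') : ⁅x, y⁆ = ⁅x', y'⁆ := by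
  have h1 : ⁅x - x', y⁆ = 0 := hg.2 _ (by rw [map_sub, hx, sub_self]) _
  have h2 : ⁅y - y', x'⁆ = 0 := hg.2 _ (by rw [map_sub, hy, sub_self]) _
  rw [sub_lie, sub_eq_zero] at h1 h2
  rw [h1, ← lie_skew, h2, lie_skew]

/-- Two homomorphisms from a perfect Lie algebra into a central extension agree as soon as they
agree modulo the kernel. -/
theorem IsPerfect.hom_ext (hK : IsPerfect k K) {g : E →ₗ⁅k⁆ L} (hg : IsCentralExtension g)
    {h h' : K →ₗ⁅k⁆ E} (H : ∀ x, g (h x) = g (h' x)) : h = h' := by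
  have : (h : K →ₗ[k] E) = h' := by
    refine LinearMap.ext_on hK ?_
    rintro _ ⟨x, y, rfl⟩
    change h ⁅x, y⁆ = h' ⁅x, y⁆
    rw [LieHom.map_lie, LieHom.map_lie]
    exact hg.lie_congr (H x) (H y)
  ext x
  exact LinearMap.congr_fun this x

namespace IsCentralExtension

/-- The bilinear map `L × L → E` induced by the bracket of a central extension `E → L`. -/
noncomputable def lieLift {g : E →ₗ⁅k⁆ L} (hg : IsCentralExtension g) : L →ₗ[k] L →ₗ[k] E :=
  -- `surjInv` is only a set-theoretic section; its failure to be linear takes values in the central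
  -- kernel and is lost in the bracket.
  LinearMap.mk₂ k (fun x y => ⁅Function.surjInv hg.1 x, Function.surjInv hg.1 y⁆)
    (fun a b y => by
      rw [← add_lie]; exact hg.lie_congr (by simp [Function.surjInv_eq]) rfl)
    (fun c a y => by
      rw [← smul_lie]; exact hg.lie_congr (by simp [Function.surjInv_eq]) rfl)
    (fun x a b => by
      rw [← lie_add]; exact hg.lie_congr rfl (by simp [Function.surjInv_eq]))
    (fun c x a => by
      rw [← lie_smul]; exact hg.lie_congr rfl (by simp [Function.surjInv_eq]))

theorem lieLift_apply {g : E →ₗ⁅k⁆ L} (hg : IsCentralExtension g) (x y : E) :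
    hg.lieLift (g x) (g y) = ⁅x, y⁆ :=
  hg.lie_congr (Function.surjInv_eq hg.1 _) (Function.surjInv_eq hg.1 _)

/-- The linear map `uce(L) → E` induced by a central extension `E → L`. -/
noncomputable def uceLiftLin {g : E →ₗ⁅k⁆ L} (hg : IsCentralExtension g) : Uce k L →ₗ[k] E :=
  (uceRel k L).liftQ (TensorProduct.lift hg.lieLift) <| by
    rw [uceRel, Submodule.span_le]
    rintro t (⟨x, rfl⟩ | ⟨x, y, z, rfl⟩)
    · exact lie_self _
    · obtain ⟨x, rfl⟩ := hg.1 x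
      obtain ⟨y, rfl⟩ := hg.1 y
      obtain ⟨z, rfl⟩ := hg.1 z
      simp only [← LieHom.map_lie, SetLike.mem_coe, LinearMap.mem_ker, map_add, lift.tmul,
        lieLift_apply]
      exact lie_jacobi x y z

theorem uceLiftLin_mk {g : E →ₗ⁅k⁆ L} (hg : IsCentralExtension g) (x y : E) :
    hg.uceLiftLin (Uce.mk k L (g x) (g y)) = ⁅x, y⁆ :=
  hg.lieLift_apply x y

theorem map_uceLiftLin {g : E →ₗ⁅k⁆ L} (hg : IsCentralExtension g) (X : Uce k L) :
    g (hg.uceLiftLin X) = Uce.u k L X := by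
  induction X using Uce.induction with
  | h0 => simp
  | hm x y =>
    obtain ⟨x, rfl⟩ := hg.1 x
    obtain ⟨y, rfl⟩ := hg.1 y
    rw [uceLiftLin_mk, LieHom.map_lie]
    rfl
  | ha X Y hX hY => rw [map_add, map_add, hX, hY, map_add]

/-- The homomorphism `uce(L) → E` over `L` induced by a central extension `E → L`. -/
noncomputable def uceLift {g : E →ₗ⁅k⁆ L} (hg : IsCentralExtension g) : Uce k L →ₗ⁅k⁆ E :=
  { hg.uceLiftLin with
    map_lie' := by
      intro X Y
      change hg.uceLiftLin (Uce.mk k L (Uce.u k L X) (Uce.u k L Y)) =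
        ⁅hg.uceLiftLin X, hg.uceLiftLin Y⁆
      rw [← hg.map_uceLiftLin, ← hg.map_uceLiftLin, uceLiftLin_mk] }

theorem uceLift_mk {g : E →ₗ⁅k⁆ L} (hg : IsCentralExtension g) (x y : E) :
    hg.uceLift (Uce.mk k L (g x) (g y)) = ⁅x, y⁆ :=
  hg.lieLift_apply x y

theorem map_uceLift {g : E →ₗ⁅k⁆ L} (hg : IsCentralExtension g) (X : Uce k L) :
    g (hg.uceLift X) = Uce.u k L X :=
  hg.map_uceLiftLin X

end IsCentralExtension

/-- Perfectness of `L` gives surjectivity of `u`; the kernel is central for any `L`, because the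
bracket of `uce(L)` is computed through `u`. -/
theorem Uce.isCentralExtension (hL : IsPerfect k L) : IsCentralExtension (Uce.u k L) := by
  refine ⟨?_, fun X hX Y => ?_⟩
  · rw [← LieHom.coe_toLinearMap, ← LinearMap.range_eq_top, ← top_le_iff, ← hL,
      Submodule.span_le]
    rintro _ ⟨x, y, rfl⟩
    exact ⟨Uce.mk k L x y, rfl⟩
  · change Uce.mk k L (Uce.u k L X) _ = 0
    rw [hX, map_zero, LinearMap.zero_apply]

/-- Since `u` is onto, `⟨u X, u Y⟩ = [X, Y]` accounts for every generator. -/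
theorem Uce.isPerfect (hL : IsPerfect k L) : IsPerfect k (Uce k L) := by
  refine top_le_iff.1 fun X _ => ?_
  induction X using Uce.induction with
  | h0 => exact zero_mem _
  | hm x y =>
    obtain ⟨X, rfl⟩ := (Uce.isCentralExtension hL).1 x
    obtain ⟨Y, rfl⟩ := (Uce.isCentralExtension hL).1 y
    exact Submodule.subset_span ⟨X, Y, rfl⟩
  | ha X Y hX hY => exact add_mem (hX trivial) (hY trivial)

theorem Uce.isCovering (hL : IsPerfect k L) : IsCovering (Uce.u k L) :=
  ⟨Uce.isCentralExtension hL, Uce.isPerfect hL⟩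

theorem IsPerfect.of_surjective (hK : IsPerfect k K) {f : K →ₗ⁅k⁆ L}
    (hf : Function.Surjective f) : IsPerfect k L := by
  have h := congrArg (Submodule.map (f : K →ₗ[k] L)) hK
  rw [Submodule.map_top, LinearMap.range_eq_top.2 hf, Submodule.map_span] at h
  refine top_le_iff.1 (h ▸ Submodule.span_mono ?_)
  rintro _ ⟨_, ⟨x, y, rfl⟩, rfl⟩
  exact ⟨f x, f y, f.map_lie x y⟩

/-- The cyclic relation read as a Leibniz rule for `⟨x, ·⟩`, the form in which weights can be
counted. -/
theorem Uce.mk_lie (x y z : L) : mk k L x ⁅y, z⁆ = mk k L ⁅x, y⁆ z + mk k L y ⁅x, z⁆ := by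
  have h := mk_cyc (k := k) x y z
  rw [mk_skew z, ← lie_skew z x, map_neg] at h
  linear_combination (norm := abel_nf) h

/-- A covering `K → L` with a homomorphism `K → uce(L)` over `L` is isomorphic to `uce(L)`. -/
noncomputable def IsCovering.uceEquiv {f : K →ₗ⁅k⁆ L} (hf : IsCovering f) (hL : IsPerfect k L)
    (ψ : K →ₗ⁅k⁆ Uce k L) (hψ : ∀ x, Uce.u k L (ψ x) = f x) : Uce k L ≃ₗ⁅k⁆ K :=
  { hf.1.uceLift with
    invFun := ψ
    left_inv := fun X => by
      -- Both composites are endomorphisms over `L` of a perfect central extension, hence equal to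
      -- the identity.
      refine DFunLike.congr_fun (f := ψ.comp hf.1.uceLift) (g := LieHom.id)
        ((Uce.isPerfect hL).hom_ext (Uce.isCentralExtension hL) fun X => ?_) X
      rw [LieHom.comp_apply, hψ, hf.1.map_uceLift]
      rfl
    right_inv := fun x => by
      refine DFunLike.congr_fun (f := hf.1.uceLift.comp ψ) (g := LieHom.id)
        (hf.2.hom_ext hf.1 fun x => ?_) x
      rw [LieHom.comp_apply, hf.1.map_uceLift, hψ]
      rfl }

end

/-- A covering that maps to `uce(L)` over `L` is universal. -/
theorem IsCovering.isUniversalCentralExtension {k : Type u} [CommRing k] {K : Type v} {L : Type v'}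
    [LieRing K] [LieAlgebra k K] [LieRing L] [LieAlgebra k L] {f : K →ₗ⁅k⁆ L}
    (hf : IsCovering f) (ψ : K →ₗ⁅k⁆ Uce k L) (hψ : ∀ x, Uce.u k L (ψ x) = f x) :
    IsUniversalCentralExtension.{u, v, v', w} f := by
  refine ⟨hf.1, fun E _ _ g hg => ⟨hg.uceLift.comp ψ, fun x => ?_, fun h hh => ?_⟩⟩
  · rw [LieHom.comp_apply, hg.map_uceLift, hψ]
  · refine hf.2.hom_ext hg fun x => ?_
    rw [hh, LieHom.comp_apply, hg.map_uceLift, hψ]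

end LieExt

/-! ### The modules `J * J` and `uider`, and the Tits-Kantor-Koecher algebras -/

namespace JordanTKK

attribute [local instance] LieRing.ofAssociativeRing

open LieExt

section
variable {k : Type*} [CommRing k]

variable (k) in
theorem eq_zero_of_two_nsmul [Invertible (2 : k)] {M : Type*} [AddCommGroup M] [Module k M]
    {x : M} (h : 2 • x = 0) : x = 0 := by
  have h2 : (2 : k) • x = 0 := by rw [two_smul, ← two_nsmul, h]
  have := congrArg (fun y => (⅟2 : k) • y) h2
  simpa [smul_smul] using this

theorem invOf_two_smul_two_nsmul [Invertible (2 : k)] {M : Type*} [AddCommGroup M] [Module k M]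
    (x : M) : (⅟2 : k) • (2 • x) = x := by
  rw [two_nsmul, ← two_smul k, smul_smul, invOf_mul_self, one_smul]

variable (k) {J : Type*} [NonAssocCommRing J] [Module k J] [IsScalarTower k J J]
  [SMulCommClass k J J]

/-! ### The module `J * J` -/

/-- The class of `a ⊗ b` in `J * J`, as a bilinear map. -/
noncomputable def starMk (J : Type*) [NonAssocCommRing J] [Module k J] [IsScalarTower k J J]
    [SMulCommClass k J J] : J →ₗ[k] J →ₗ[k] JStar k J :=
  (TensorProduct.mk k J J).compr₂ (starRel k J).mkQ

theorem star_eq (a b : J) : star k a b = starMk k J a b := rfl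

variable {k}

theorem starMk_cyc (a b c : J) :
    starMk k J a (b * c) + starMk k J b (c * a) + starMk k J c (a * b) = 0 :=
  (Submodule.Quotient.mk_eq_zero _).2 (Submodule.subset_span (Or.inl ⟨a, b, c, rfl⟩))

theorem starMk_skew (a b : J) : starMk k J a b = -starMk k J b a :=
  eq_neg_of_add_eq_zero_left <|
    (Submodule.Quotient.mk_eq_zero _).2 (Submodule.subset_span (Or.inr ⟨a, b, rfl⟩))

/-- The triple `(a, 1, 1)` in the cyclic relation gives `a * 1 + 2 (1 * a)`, which is `1 * a` by
skewness. This is why the retraction kills the correction term `1 ⋄ ab`. -/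
theorem starMk_one (a : J) : starMk k J 1 a = 0 := by
  have h := starMk_cyc (k := k) a 1 1
  rw [one_mul, one_mul, mul_one, starMk_skew a 1] at h
  simpa using h

/-- A rewriting rule that clears products from the left factor. -/
theorem starMk_mul (a b c : J) :
    starMk k J (a * b) c = starMk k J a (b * c) + starMk k J b (a * c) := by
  have h := starMk_cyc (k := k) a b c
  rw [starMk_skew c, mul_comm c a] at h
  rw [eq_comm, ← sub_eq_zero, sub_eq_add_neg, h]

theorem induction_star {p : JStar k J → Prop} (t : JStar k J) (h0 : p 0)
    (hm : ∀ x y, p (starMk k J x y)) (ha : ∀ X Y, p X → p Y → p (X + Y)) : p t := by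
  obtain ⟨t, rfl⟩ := Submodule.Quotient.mk_surjective _ t
  induction t using TensorProduct.induction_on with
  | zero => exact h0
  | tmul x y => exact hm x y
  | add a b h1 h2 => exact ha _ _ h1 h2

/-- The first relation of `uider` holds in `J * J`. Only commutativity and the relations of `J * J`
enter, not the Jordan identity. -/
theorem starMk_rel (x y u v : J) :
    starMk k J (D k J x y u) v - starMk k J u (D k J y x v)
      + (starMk k J (D k J u v x) y - starMk k J x (D k J v u y)) = 0 := by
  -- Clearing left factors does not give a unique form: a product such as `(yu) * (xv)` may be
  -- expanded on either side. `e2` and `e3` reconcile the two expansions.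
  have e1 := starMk_cyc (k := k) y v (x * u)
  have e2 := starMk_skew (k := k) (y * u) (x * v)
  have e3 := starMk_skew (k := k) (x * y) (u * v)
  simp only [D_apply, map_nsmul, map_add, map_sub, LinearMap.smul_apply, LinearMap.add_apply,
    LinearMap.sub_apply, starMk_mul, mul_comm] at e1 e2 e3 ⊢
  linear_combination (norm := abel_nf) (2 : ℤ) • (e2 + e3 - e1)

theorem lift_starMk_tact (x y u v : J) :
    TensorProduct.lift (starMk k J) (tact k J (delta k J x y) (u ⊗ₜ[k] v)) =
      starMk k J (D k J x y u) v - starMk k J u (D k J y x v) := by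
  change starMk k J (D k J x y u) v + starMk k J u (-(D k J y x v)) = _
  rw [map_neg, sub_eq_add_neg]

theorem diamond_rel (x y u v : J) :
    diamond k J (D k J x y u) v - diamond k J u (D k J y x v)
      + (diamond k J (D k J u v x) y - diamond k J x (D k J v u y)) = 0 := by
  have h : (uiderRel k J).mkQ (tact k J (delta k J x y) (u ⊗ₜ[k] v) +
        tact k J (delta k J u v) (x ⊗ₜ[k] y)) = 0 :=
    (Submodule.Quotient.mk_eq_zero _).2 (Submodule.subset_span (Or.inl ⟨x, y, u, v, rfl⟩))
  change diamond k J (D k J x y u) v + diamond k J u (-(D k J y x v))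
    + (diamond k J (D k J u v x) y + diamond k J x (-(D k J v u y))) = 0 at h
  simpa only [map_neg, ← sub_eq_add_neg] using h

/-! ### The maps between `J * J` and `uider` -/

section
variable [Invertible (2 : k)]

variable (k J) in
/-- The retraction `a ⋄ b ↦ a * b` of `uider` onto `J * J`. -/
noncomputable def starOfUIder : UIder k J →ₗ[k] JStar k J :=
  (uiderRel k J).liftQ (TensorProduct.lift (starMk k J)) <| by
    rw [uiderRel, Submodule.span_le]
    rintro t (⟨x, y, u, v, rfl⟩ | ⟨x, y, rfl⟩)
    · rw [SetLike.mem_coe, LinearMap.mem_ker, map_add, lift_starMk_tact, lift_starMk_tact,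
        starMk_rel]
    -- Twice the second relation is the diagonal case of the first.
    · refine eq_zero_of_two_nsmul k ?_
      rw [two_nsmul, lift_starMk_tact, starMk_rel]

@[simp] theorem starOfUIder_diamond (a b : J) :
    starOfUIder k J (diamond k J a b) = starMk k J a b := rfl

/-- In the relation for `(1, 1)` and `(a, 1)` every operator acts as a doubling; two terms cancel
and `2 (a ⋄ 1 - 1 ⋄ a)` is left. -/
theorem diamond_one_right (a : J) : diamond k J a 1 = diamond k J 1 a := by
  have h := diamond_rel (k := k) 1 1 a 1
  rw [← sub_eq_zero]
  refine eq_zero_of_two_nsmul k ?_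
  simp only [D_apply, map_nsmul, map_add, map_sub, LinearMap.smul_apply, LinearMap.add_apply,
    LinearMap.sub_apply, mul_one, one_mul] at h
  linear_combination (norm := abel_nf) h

/-- The relation for `(a, 1)` and `(b, 1)`. It is the skewness of `J * J`, up to terms in `1 ⋄ J`.
-/
theorem diamond_add_swap (a b : J) :
    diamond k J a b + diamond k J b a = 2 • diamond k J 1 (a * b) := by
  have h := diamond_rel (k := k) a 1 b 1
  rw [eq_comm, ← sub_eq_zero]
  refine eq_zero_of_two_nsmul k ?_
  simp only [D_apply, map_nsmul, map_add, map_sub, LinearMap.smul_apply, LinearMap.add_apply,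
    LinearMap.sub_apply, mul_one, one_mul, diamond_one_right, mul_comm b a] at h
  linear_combination (norm := abel_nf) h

/-- The relation for `(a, b)` and `(c, 1)` contains `ac ⋄ b` instead of `b ⋄ ca`; `diamond_add_swap`
exchanges them. It is the cyclic relation of `J * J`, up to terms in `1 ⋄ J`. -/
theorem diamond_cyc (a b c : J) :
    diamond k J a (b * c) + diamond k J b (c * a) + diamond k J c (a * b) =
      diamond k J 1 (a * (b * c) + b * (c * a) + c * (a * b)) := by
  have h := diamond_rel (k := k) a b c 1
  have h2 := diamond_add_swap (k := k) (a * c) b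
  rw [eq_comm, ← sub_eq_zero]
  refine eq_zero_of_two_nsmul k ?_
  simp only [D_apply, map_nsmul, map_add, map_sub, LinearMap.smul_apply, LinearMap.add_apply,
    LinearMap.sub_apply, mul_one, diamond_one_right, mul_comm] at h h2 ⊢
  linear_combination (norm := abel_nf) h - (2 : ℤ) • h2

variable (k J) in
/-- The bilinear map `(a, b) ↦ a ⋄ b - 1 ⋄ ab`. -/
noncomputable def diamondSub : J →ₗ[k] J →ₗ[k] UIder k J :=
  diamond k J - (LinearMap.mul k J).compr₂ (diamond k J 1)

variable (k J) in
/-- The embedding `a * b ↦ a ⋄ b - 1 ⋄ ab` of `J * J` into `uider`. -/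
noncomputable def uiderOfStar : JStar k J →ₗ[k] UIder k J :=
  (starRel k J).liftQ (TensorProduct.lift (diamondSub k J)) <| by
    have e : ∀ a b : J, TensorProduct.lift (diamondSub k J) (a ⊗ₜ[k] b) =
      diamond k J a b - diamond k J 1 (a * b) := fun _ _ => rfl
    rw [starRel, Submodule.span_le]
    rintro t (⟨a, b, c, rfl⟩ | ⟨a, b, rfl⟩)
    · have h := diamond_cyc (k := k) a b c
      simp only [SetLike.mem_coe, LinearMap.mem_ker, map_add, e] at h ⊢
      linear_combination (norm := abel_nf) h
    · have h := diamond_add_swap (k := k) a b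
      simp only [SetLike.mem_coe, LinearMap.mem_ker, map_add, e, mul_comm b a] at h ⊢
      linear_combination (norm := abel_nf) h

@[simp] theorem uiderOfStar_starMk (a b : J) :
    uiderOfStar k J (starMk k J a b) = diamond k J a b - diamond k J 1 (a * b) := rfl

theorem starOfUIder_uiderOfStar (t : JStar k J) : starOfUIder k J (uiderOfStar k J t) = t := by
  induction t using induction_star with
  | h0 => simp
  | hm x y => simp [starMk_one]
  | ha X Y hX hY => rw [map_add, map_add, hX, hY]

theorem uiderOfStar_injective : Function.Injective (uiderOfStar k J) :=
  Function.LeftInverse.injective starOfUIder_uiderOfStar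

/-! ### Comparison of the kernels of `ud_JP` and `ud_JA` -/

variable [IsCommJordan J]

@[simp] theorem udJP_diamond (a b : J) : (udJP k J (diamond k J a b)).1 = delta k J a b := rfl

@[simp] theorem udJA_starMk (a b : J) : udJA k J (starMk k J a b) = (2 : k) • ⁅L k a, L k b⁆ := rfl

/-- Since `D(a,b) = 2 ([L_a, L_b] + L_{ab})`, subtracting `δ(1, ab)` removes the multiplication
`L_{ab}` from both components and leaves the same derivation in each. -/
theorem udJP_uiderOfStar (t : JStar k J) :
    (udJP k J (uiderOfStar k J t)).1 = (udJA k J t, udJA k J t) := by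
  induction t using induction_star with
  | h0 => rw [map_zero, map_zero, map_zero]; rfl
  | hm x y =>
    rw [uiderOfStar_starMk, map_sub, LHat.i_sub, udJP_diamond, udJP_diamond, udJA_starMk]
    ext z <;>
    · simp [Ring.lie_def, two_smul, mul_comm]
      abel
  | ha X Y hX hY => simp only [map_add, LHat.i_add, hX, hY, Prod.mk_add_mk]

/-- Because `D(x,y)1 = 2xy`, the correction term `1 ⋄ xy` depends only on `ud_JP(x ⋄ y)`. On `ker
ud_JP` it vanishes, so there the retraction inverts `β`. -/
theorem uiderOfStar_starOfUIder (X : UIder k J) :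
    uiderOfStar k J (starOfUIder k J X) =
      X - (⅟2 : k) • diamond k J 1 ((udJP k J X).1.1 1) := by
  induction X using UIder.induction with
  | h0 => simp
  | hm x y =>
    rw [starOfUIder_diamond, uiderOfStar_starMk, udJP_diamond, delta_apply, D_apply, mul_one,
      mul_one, one_mul, mul_comm y x, add_sub_cancel_right, map_nsmul, invOf_two_smul_two_nsmul]
  | ha X Y hX hY =>
    simp only [map_add, LHat.i_add, Prod.fst_add, LinearMap.add_apply, hX, hY, smul_add]
    abel

theorem udJP_uiderOfStar_eq_zero (t : JStar k J) :
    udJP k J (uiderOfStar k J t) = 0 ↔ udJA k J t = 0 := by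
  rw [Subtype.ext_iff, udJP_uiderOfStar]
  exact ⟨fun h => congrArg Prod.fst h, fun h => Prod.ext h h⟩

/-- Every element of `J * J` is a finite sum of classes `a * b`, and the factor `2` in `ud_JA` is
invertible. -/
theorem HC_eq_ker : HC k J = {t : JStar k J | udJA k J t = 0} := by
  have e : ∀ (n : ℕ) (a b : Fin n → J), udJA k J (∑ i, star k (a i) (b i)) =
      (2 : k) • ∑ i, ⁅L k (a i), L k (b i)⁆ := by
    intro n a b
    rw [map_sum, Finset.smul_sum]
    rfl
  ext t
  constructor
  · rintro ⟨n, a, b, rfl, h⟩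
    rw [Set.mem_ofPred_eq, e, h, smul_zero]
  · intro h
    obtain ⟨n, a, b, rfl⟩ : ∃ (n : ℕ) (a b : Fin n → J), t = ∑ i, star k (a i) (b i) := by
      clear h
      induction t using induction_star with
      | h0 => exact ⟨0, Fin.elim0, Fin.elim0, rfl⟩
      | hm x y => exact ⟨1, fun _ => x, fun _ => y, by simp [star_eq]⟩
      | ha X Y hX hY =>
        obtain ⟨n, a, b, rfl⟩ := hX
        obtain ⟨m, c, d, rfl⟩ := hY
        exact ⟨n + m, Fin.append a c, Fin.append b d, by simp [Fin.sum_univ_add]⟩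
    refine ⟨n, a, b, rfl, eq_zero_of_two_nsmul k ?_⟩
    rw [Set.mem_ofPred_eq, e, two_smul, ← two_nsmul] at h
    exact h

theorem image_HC : uiderOfStar k J '' HC k J = {X | udJP k J X = 0} := by
  rw [HC_eq_ker]
  ext X
  constructor
  · rintro ⟨t, ht, rfl⟩
    exact (udJP_uiderOfStar_eq_zero t).2 ht
  · intro h
    have hX : uiderOfStar k J (starOfUIder k J X) = X := by
      rw [uiderOfStar_starOfUIder, show udJP k J X = 0 from h]
      simp
    refine ⟨_, (udJP_uiderOfStar_eq_zero _).1 ?_, hX⟩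
    rw [hX]
    exact h

end
end

section
variable {k : Type*} [CommRing k] [Invertible (2 : k)] {J : Type*} [NonAssocCommRing J]
  [Module k J] [IsScalarTower k J J] [SMulCommClass k J J]

theorem invOf_two_smul_D_one_one (a : J) : (⅟2 : k) • D k J 1 1 a = a := by
  rw [D_apply, one_mul, one_mul, mul_one, mul_one, add_sub_cancel_right, invOf_two_smul_two_nsmul]

variable [IsCommJordan J]

@[simp] theorem instr_zero_fst : (0 : instr k J).1.1 = 0 := rfl
@[simp] theorem instr_zero_snd : (0 : instr k J).1.2 = 0 := rfl

/-! ### The central extension `uTKK → TKK` -/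

theorem udHat_surjective : Function.Surjective (udHat k J) := fun p => by
  obtain ⟨X, hX⟩ := udJP_surjective k J p.mid
  exact ⟨⟨p.pos, X, p.neg⟩, LHat.ext rfl hX rfl⟩

theorem udHat_eq_zero {p : UTKK k J} :
    udHat k J p = 0 ↔ p.pos = 0 ∧ udJP k J p.mid = 0 ∧ p.neg = 0 :=
  LHat.ext_iff

theorem udHat_isCentralExtension : IsCentralExtension (udHat k J) := by
  refine ⟨udHat_surjective, fun p hp q => ?_⟩
  obtain ⟨h1, h2, h3⟩ := udHat_eq_zero.1 hp
  have h4 : ⁅p.mid, q.mid⁆ = 0 := by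
    change act k J (udJP k J p.mid) q.mid = 0
    rw [h2, map_zero, LinearMap.zero_apply]
  ext
  · simp [h1, h2]
  · simp [h1, h3, h4]
  · simp [h3, h2]

theorem UTKK_isPerfect : IsPerfect k (UTKK k J) := by
  refine top_le_iff.1 fun p _ => ?_
  -- `½ (1 ⋄ 1)` acts as `1` on `J⁺` and as `-1` on `J⁻`, whence the reversed bracket in `hneg`.
  let η : UTKK k J := ⟨0, (⅟2 : k) • diamond k J 1 1, 0⟩
  have hpos : (⟨p.pos, 0, 0⟩ : UTKK k J) = ⁅η, (⟨p.pos, 0, 0⟩ : UTKK k J)⁆ := by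
    ext
    · simpa [η, LHat.i_smul] using (invOf_two_smul_D_one_one (k := k) p.pos).symm
    · simp [η]
    · simp [η]
  have hneg : (⟨0, 0, p.neg⟩ : UTKK k J) = ⁅(⟨0, 0, p.neg⟩ : UTKK k J), η⁆ := by
    ext
    · simp [η]
    · simp [η]
    · simpa [η, LHat.i_smul] using (invOf_two_smul_D_one_one (k := k) p.neg).symm
  have hmid : inc k J p.mid ∈ Submodule.span k {z : UTKK k J | ∃ x y : UTKK k J, z = ⁅x, y⁆} := by
    induction p.mid using UIder.induction with
    | h0 => rw [map_zero]; exact zero_mem _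
    | hm x y =>
      refine Submodule.subset_span ⟨⟨x, 0, 0⟩, ⟨0, 0, y⟩, ?_⟩
      ext <;> simp [inc]
    | ha X Y hX hY => rw [map_add]; exact add_mem hX hY
  have : p = ⟨p.pos, 0, 0⟩ + inc k J p.mid + ⟨0, 0, p.neg⟩ := by ext <;> simp [inc]
  rw [this]
  exact add_mem (add_mem (Submodule.subset_span ⟨_, _, hpos⟩) hmid)
    (Submodule.subset_span ⟨_, _, hneg⟩)

theorem udHat_isCovering : IsCovering (udHat k J) := ⟨udHat_isCentralExtension, UTKK_isPerfect⟩

theorem TKK_isPerfect : IsPerfect k (TKK k J) := UTKK_isPerfect.of_surjective udHat_surjective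

/-! ### The homomorphism `uTKK → uce(TKK)` -/

variable (k J) in
/-- The inclusion of `J⁺` into `TKK`. -/
def posLin : J →ₗ[k] TKK k J where
  toFun := inPos k
  map_add' _ _ := LHat.ext rfl (add_zero 0).symm (add_zero 0).symm
  map_smul' c _ := LHat.ext rfl (smul_zero c).symm (smul_zero c).symm

variable (k J) in
/-- The inclusion of `J⁻` into `TKK`. -/
def negLin : J →ₗ[k] TKK k J where
  toFun := inNeg k
  map_add' _ _ := LHat.ext (add_zero 0).symm (add_zero 0).symm rfl
  map_smul' c _ := LHat.ext (smul_zero c).symm (smul_zero c).symm rfl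

variable (k J) in
/-- The inclusion of `instr` into `TKK`. -/
def midLin : instr k J →ₗ[k] TKK k J where
  toFun T := ⟨0, T, 0⟩
  map_add' _ _ := LHat.ext (add_zero 0).symm rfl (add_zero 0).symm
  map_smul' c _ := LHat.ext (smul_zero c).symm rfl (smul_zero c).symm

@[simp] theorem posLin_pos (a : J) : (posLin k J a).pos = a := rfl
@[simp] theorem posLin_mid (a : J) : (posLin k J a).mid = 0 := rfl
@[simp] theorem posLin_neg (a : J) : (posLin k J a).neg = 0 := rfl
@[simp] theorem negLin_pos (a : J) : (negLin k J a).pos = 0 := rfl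
@[simp] theorem negLin_mid (a : J) : (negLin k J a).mid = 0 := rfl
@[simp] theorem negLin_neg (a : J) : (negLin k J a).neg = a := rfl
@[simp] theorem midLin_pos (T : instr k J) : (midLin k J T).pos = 0 := rfl
@[simp] theorem midLin_mid (T : instr k J) : (midLin k J T).mid = T := rfl
@[simp] theorem midLin_neg (T : instr k J) : (midLin k J T).neg = 0 := rfl

theorem lie_posLin_posLin (a b : J) : ⁅posLin k J a, posLin k J b⁆ = 0 := by
  ext <;> simp

theorem lie_negLin_negLin (a b : J) : ⁅negLin k J a, negLin k J b⁆ = 0 := by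
  ext <;> simp

theorem lie_posLin_negLin (a b : J) :
    ⁅posLin k J a, negLin k J b⁆ = midLin k J (udJP k J (diamond k J a b)) := by
  ext1 <;> simp

theorem lie_midLin_posLin (T : instr k J) (a : J) :
    ⁅midLin k J T, posLin k J a⁆ = posLin k J (T.1.1 a) := by
  ext1 <;> simp

theorem lie_midLin_negLin (T : instr k J) (a : J) :
    ⁅midLin k J T, negLin k J a⁆ = negLin k J (T.1.2 a) := by
  ext1 <;> simp

/-! ### Weights of the grading element in `uce(TKK)` -/

variable (k J) in
/-- The grading element `½ δ(1, 1)` of `TKK`. -/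
noncomputable def grading : TKK k J := midLin k J ((⅟2 : k) • udJP k J (diamond k J 1 1))

theorem lie_grading_posLin (a : J) : ⁅grading k J, posLin k J a⁆ = posLin k J a := by
  rw [grading, lie_midLin_posLin]
  exact congrArg _ (invOf_two_smul_D_one_one a)

theorem lie_grading_negLin (a : J) : ⁅grading k J, negLin k J a⁆ = -negLin k J a := by
  rw [grading, lie_midLin_negLin, ← map_neg]
  refine congrArg _ ?_
  change (⅟2 : k) • -(D k J 1 1 a) = -a
  rw [_root_.smul_neg, invOf_two_smul_D_one_one]

/-- `δ(1,1) = (2, -2)` is scalar on each component, so it commutes with every `T`. -/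
theorem lie_grading_midLin (T : instr k J) : ⁅grading k J, midLin k J T⁆ = 0 := by
  have h : ∀ a : J, D k J 1 1 a = (2 : k) • a := fun a => by simp [two_smul]
  ext1
  · simp [grading]
  · simp only [grading, LHat.lie_mid, midLin_pos, midLin_mid, midLin_neg, map_zero,
      add_zero, sub_zero, smul_lie]
    ext a <;> simp [h, -D_apply]
  · simp [grading]

/-- Applying `⟨η, ·⟩` to `[a, b] = 0` gives `2 ⟨a, b⟩ = 0`, as both arguments have weight `1`. -/
theorem mk_posLin_posLin (a b : J) : Uce.mk k (TKK k J) (posLin k J a) (posLin k J b) = 0 := by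
  have h := Uce.mk_lie (k := k) (grading k J) (posLin k J a) (posLin k J b)
  rw [lie_posLin_posLin, lie_grading_posLin, lie_grading_posLin, map_zero, ← two_nsmul] at h
  exact eq_zero_of_two_nsmul k h.symm

theorem mk_negLin_negLin (a b : J) : Uce.mk k (TKK k J) (negLin k J a) (negLin k J b) = 0 := by
  have h := Uce.mk_lie (k := k) (grading k J) (negLin k J a) (negLin k J b)
  rw [lie_negLin_negLin, lie_grading_negLin, lie_grading_negLin, map_zero, map_neg, map_neg,
    LinearMap.neg_apply, ← neg_add, ← two_nsmul, zero_eq_neg] at h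
  exact eq_zero_of_two_nsmul k h

/-- Expand `⟨η, [T, a]⟩`: `T` has weight `0` and `a` has weight `1`, so only `⟨T, a⟩` survives. -/
theorem mk_midLin_posLin (T : instr k J) (a : J) :
    Uce.mk k (TKK k J) (midLin k J T) (posLin k J a) =
      Uce.mk k (TKK k J) (grading k J) (posLin k J (T.1.1 a)) := by
  have h := Uce.mk_lie (k := k) (grading k J) (midLin k J T) (posLin k J a)
  rw [lie_midLin_posLin, lie_grading_midLin, lie_grading_posLin, map_zero, LinearMap.zero_apply,
    zero_add] at h
  exact h.symm

theorem mk_midLin_negLin (T : instr k J) (a : J) :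
    Uce.mk k (TKK k J) (midLin k J T) (negLin k J a) =
      -Uce.mk k (TKK k J) (grading k J) (negLin k J (T.1.2 a)) := by
  have h := Uce.mk_lie (k := k) (grading k J) (midLin k J T) (negLin k J a)
  rw [lie_midLin_negLin, lie_grading_midLin, lie_grading_negLin, map_zero, LinearMap.zero_apply,
    zero_add, map_neg] at h
  rw [h, neg_neg]

/-- The right side is the image of `T.(a ⋄ b)`. With `T = δ(x,y)` the relations of `uider` become
skewness and alternation of `⟨·,·⟩` on `instr`. -/
theorem mk_midLin_lie (T : instr k J) (a b : J) :
    Uce.mk k (TKK k J) (midLin k J T) (midLin k J (udJP k J (diamond k J a b))) =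
      Uce.mk k (TKK k J) (posLin k J (T.1.1 a)) (negLin k J b) +
        Uce.mk k (TKK k J) (posLin k J a) (negLin k J (T.1.2 b)) := by
  rw [← lie_posLin_negLin, Uce.mk_lie, lie_midLin_posLin, lie_midLin_negLin]

variable (k J) in
/-- The linear map `uider → uce(TKK)`, `a ⋄ b ↦ ⟨a, b⟩`. -/
noncomputable def uceOfUIder : UIder k J →ₗ[k] Uce k (TKK k J) :=
  (uiderRel k J).liftQ
    (TensorProduct.lift ((Uce.mk k (TKK k J)).compl₁₂ (posLin k J) (negLin k J))) <| by
    have e : ∀ x y u v : J,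
        TensorProduct.lift ((Uce.mk k (TKK k J)).compl₁₂ (posLin k J) (negLin k J))
          (tact k J (delta k J x y) (u ⊗ₜ[k] v)) =
        Uce.mk k (TKK k J) (midLin k J (udJP k J (diamond k J x y)))
          (midLin k J (udJP k J (diamond k J u v))) :=
      fun x y u v => (mk_midLin_lie (udJP k J (diamond k J x y)) u v).symm
    rw [uiderRel, Submodule.span_le]
    rintro t (⟨x, y, u, v, rfl⟩ | ⟨x, y, rfl⟩)
    · rw [SetLike.mem_coe, LinearMap.mem_ker, map_add, e, e, Uce.mk_skew, neg_add_cancel]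
    · rw [SetLike.mem_coe, LinearMap.mem_ker, e, Uce.mk_self]

@[simp] theorem uceOfUIder_diamond (a b : J) : uceOfUIder k J (diamond k J a b) =
    Uce.mk k (TKK k J) (posLin k J a) (negLin k J b) := rfl

theorem u_uceOfUIder (X : UIder k J) :
    Uce.u k (TKK k J) (uceOfUIder k J X) = midLin k J (udJP k J X) := by
  induction X using UIder.induction with
  | h0 => simp only [map_zero]
  | hm x y => exact lie_posLin_negLin x y
  | ha X Y hX hY => simp only [map_add, hX, hY]

theorem uceOfUIder_lie (X Y : UIder k J) : uceOfUIder k J ⁅X, Y⁆ =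
    Uce.mk k (TKK k J) (midLin k J (udJP k J X)) (midLin k J (udJP k J Y)) := by
  induction Y using UIder.induction with
  | h0 => simp only [lie_zero, map_zero]
  | hm x y => exact (mk_midLin_lie (udJP k J X) x y).symm
  | ha Y Z hY hZ => simp only [lie_add, map_add, hY, hZ]

variable (k J) in
/-- The linear map underlying the homomorphism `uTKK → uce(TKK)`. -/
noncomputable def uceOfUTKKLin : UTKK k J →ₗ[k] Uce k (TKK k J) where
  -- The minus sign compensates `[η, b] = -b`, so that the map lies over `TKK`.
  toFun p := Uce.mk k (TKK k J) (grading k J) (posLin k J p.pos) + uceOfUIder k J p.mid -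
    Uce.mk k (TKK k J) (grading k J) (negLin k J p.neg)
  map_add' p q := by
    simp only [LHat.add_pos, LHat.add_mid, LHat.add_neg, map_add]
    abel
  map_smul' c p := by
    simp only [LHat.smul_pos, LHat.smul_mid, LHat.smul_neg, map_smul, RingHom.id_apply, smul_add,
      smul_sub]

theorem uceOfUTKKLin_apply (p : UTKK k J) : uceOfUTKKLin k J p =
    Uce.mk k (TKK k J) (grading k J) (posLin k J p.pos) + uceOfUIder k J p.mid -
      Uce.mk k (TKK k J) (grading k J) (negLin k J p.neg) := rfl

theorem udHat_eq (p : UTKK k J) : udHat k J p =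
    posLin k J p.pos + midLin k J (udJP k J p.mid) + negLin k J p.neg := by
  ext1 <;> simp [udHat]

theorem u_uceOfUTKKLin (p : UTKK k J) :
    Uce.u k (TKK k J) (uceOfUTKKLin k J p) = udHat k J p := by
  have e : ∀ x y : TKK k J, Uce.u k (TKK k J) (Uce.mk k (TKK k J) x y) = ⁅x, y⁆ := fun _ _ => rfl
  rw [uceOfUTKKLin_apply, udHat_eq, map_sub, map_add, e, e, u_uceOfUIder, lie_grading_posLin,
    lie_grading_negLin, sub_neg_eq_add]

/-- Expand `⟨p, q⟩` by degree: the `J⁺J⁺` and `J⁻J⁻` terms vanish, mixed terms with `instr` reduce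
to `⟨η, ·⟩`, and the rest is the image of the middle component. -/
theorem uceOfUTKKLin_lie (p q : UTKK k J) :
    uceOfUTKKLin k J ⁅p, q⁆ = Uce.mk k (TKK k J) (udHat k J p) (udHat k J q) := by
  have h1 := Uce.mk_skew (k := k) (posLin k J p.pos) (midLin k J (udJP k J q.mid))
  have h2 := Uce.mk_skew (k := k) (negLin k J p.neg) (midLin k J (udJP k J q.mid))
  have h3 := Uce.mk_skew (k := k) (negLin k J p.neg) (posLin k J q.pos)
  rw [mk_midLin_posLin] at h1
  rw [mk_midLin_negLin] at h2
  have hp : ⁅p, q⁆.pos = (udJP k J p.mid).1.1 q.pos - (udJP k J q.mid).1.1 p.pos := rfl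
  have hn : ⁅p, q⁆.neg = (udJP k J p.mid).1.2 q.neg - (udJP k J q.mid).1.2 p.neg := rfl
  have hm : ⁅p, q⁆.mid =
    ⁅p.mid, q.mid⁆ + diamond k J p.pos q.neg - diamond k J q.pos p.neg := rfl
  refine Eq.trans ?_ (congrArg₂ (fun x y => Uce.mk k (TKK k J) x y)
    (udHat_eq p).symm (udHat_eq q).symm)
  rw [uceOfUTKKLin_apply, hp, hn, hm]
  simp only [map_add, map_sub, LinearMap.add_apply, h1, h2, h3, mk_posLin_posLin,
    mk_negLin_negLin, mk_midLin_posLin, mk_midLin_negLin, uceOfUIder_lie, uceOfUIder_diamond]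
  abel

theorem uceOfUTKKLin_bracket (p q : UTKK k J) :
    uceOfUTKKLin k J ⁅p, q⁆ = ⁅uceOfUTKKLin k J p, uceOfUTKKLin k J q⁆ := by
  have e : ∀ r : UTKK k J, Uce.uLin k (TKK k J) (uceOfUTKKLin k J r) = udHat k J r :=
    u_uceOfUTKKLin
  rw [Uce.lie_def, e, e, uceOfUTKKLin_lie]

variable (k J) in
/-- The homomorphism `uTKK → uce(TKK)` over `TKK`. -/
noncomputable def uceOfUTKK : UTKK k J →ₗ⁅k⁆ Uce k (TKK k J) :=
  { uceOfUTKKLin k J with map_lie' := fun {p q} => uceOfUTKKLin_bracket p q }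

theorem u_uceOfUTKK (p : UTKK k J) : Uce.u k (TKK k J) (uceOfUTKK k J p) = udHat k J p :=
  u_uceOfUTKKLin p

/-! ### The isomorphism `uce(TKK) ≅ uTKK` and the kernels -/

variable (k J) in
/-- The isomorphism `uce(TKK) ≃ uTKK` over `TKK`. -/
noncomputable def uceEquivUTKK : Uce k (TKK k J) ≃ₗ⁅k⁆ UTKK k J :=
  udHat_isCovering.uceEquiv TKK_isPerfect (uceOfUTKK k J) u_uceOfUTKK

theorem udHat_uceEquivUTKK (X : Uce k (TKK k J)) :
    udHat k J (uceEquivUTKK k J X) = Uce.u k (TKK k J) X :=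
  udHat_isCentralExtension.map_uceLift X

theorem uceEquivUTKK_mk (a b : J) :
    uceEquivUTKK k J (Uce.mk k (TKK k J) (inPos k a) (inNeg k b)) = inc k J (diamond k J a b) := by
  -- The isomorphism sends `⟨x, y⟩` to the bracket of any preimages of `x` and `y`; the homogeneous
  -- ones have bracket `a ⋄ b`.
  have ha : inPos k a = udHat k J ⟨a, 0, 0⟩ := LHat.ext rfl (map_zero (udJP k J)).symm rfl
  have hb : inNeg k b = udHat k J ⟨0, 0, b⟩ := LHat.ext rfl (map_zero (udJP k J)).symm rfl
  refine (congrArg (uceEquivUTKK k J) (by rw [ha, hb])).trans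
    ((udHat_isCentralExtension.uceLift_mk _ _).trans ?_)
  ext1 <;> simp [inc]

theorem ker_udHat : {Z | udHat k J Z = 0} = inc k J '' {X | udJP k J X = 0} := by
  ext p
  constructor
  · intro h
    obtain ⟨h1, h2, h3⟩ := udHat_eq_zero.1 h
    exact ⟨p.mid, h2, LHat.ext h1.symm rfl h3.symm⟩
  · rintro ⟨X, hX, rfl⟩
    exact udHat_eq_zero.2 ⟨rfl, hX, rfl⟩

theorem image_ker_u : uceEquivUTKK k J '' {Z | Uce.u k (TKK k J) Z = 0} =
    inc k J '' {X | udJP k J X = 0} := by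
  rw [← ker_udHat]
  ext p
  constructor
  · rintro ⟨Z, hZ, rfl⟩
    exact (udHat_uceEquivUTKK Z).trans hZ
  · intro h
    refine ⟨(uceEquivUTKK k J).symm p, ?_, LieEquiv.apply_symm_apply _ p⟩
    have h' := udHat_uceEquivUTKK ((uceEquivUTKK k J).symm p)
    rw [LieEquiv.apply_symm_apply] at h'
    exact h'.symm.trans h

end

end JordanTKK

theorem mainTheorem8 {k : Type u} [CommRing k] [Invertible (2 : k)]
    {J : Type v} [NonAssocCommRing J] [Module k J] [IsScalarTower k J J] [SMulCommClass k J J]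
    [IsCommJordan J] :
    -- `HC(J) = ker(ud_JA)`
    JordanTKK.HC k J = {t : JordanTKK.JStar k J | JordanTKK.udJA k J t = 0} ∧
    -- `u : uce(TKK(𝐉)) → TKK(𝐉)` is a universal central extension and a covering
    LieExt.IsUniversalCentralExtension.{u, v, v, w} (LieExt.Uce.u k (JordanTKK.TKK k J)) ∧
    LieExt.IsCovering (LieExt.Uce.u k (JordanTKK.TKK k J)) ∧
    -- so is `uTKK(𝐉) → TKK(𝐉)`
    LieExt.IsUniversalCentralExtension.{u, v, v, w} (JordanTKK.udHat k J) ∧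
    LieExt.IsCovering (JordanTKK.udHat k J) ∧
    ∃ (β : JordanTKK.JStar k J →ₗ[k] JordanTKK.UIder k J)
      (φ : LieExt.Uce k (JordanTKK.TKK k J) ≃ₗ⁅k⁆ JordanTKK.UTKK k J),
      -- `β : J * J → 𝐉 ⋄ 𝐉`, `a * b ↦ a ⋄ b - 1 ⋄ ab`, identifies `J * J` with a submodule
      (∀ a b : J, β (JordanTKK.star k a b) =
        JordanTKK.diamond k J a b - JordanTKK.diamond k J 1 (a * b)) ∧
      Function.Injective β ∧
      -- `φ` is an isomorphism over `TKK(𝐉)` with `⟨a, b⟩ ↦ a ⋄ b` for `a ∈ J⁺`, `b ∈ J⁻`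
      (∀ X, JordanTKK.udHat k J (φ X) = LieExt.Uce.u k (JordanTKK.TKK k J) X) ∧
      (∀ a b : J, φ (LieExt.Uce.mk k (JordanTKK.TKK k J) (JordanTKK.inPos k a)
        (JordanTKK.inNeg k b)) = JordanTKK.inc k J (JordanTKK.diamond k J a b)) ∧
      -- `HC(J) = ker(ud_JP)`
      β '' JordanTKK.HC k J = {X | JordanTKK.udJP k J X = 0} ∧
      -- `ker(uTKK(𝐉) → TKK(𝐉)) = ker(ud_JP)`
      {Z | JordanTKK.udHat k J Z = 0} =
        JordanTKK.inc k J '' {X | JordanTKK.udJP k J X = 0} ∧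
      -- `ker(u) = ker(ud_JP)`
      φ '' {Z | LieExt.Uce.u k (JordanTKK.TKK k J) Z = 0} =
        JordanTKK.inc k J '' {X | JordanTKK.udJP k J X = 0} := by
  exact ⟨JordanTKK.HC_eq_ker,
    -- For `uce` itself the comparison map to `uce` is the identity.
    (LieExt.Uce.isCovering JordanTKK.TKK_isPerfect).isUniversalCentralExtension LieHom.id
      fun _ => rfl,
    LieExt.Uce.isCovering JordanTKK.TKK_isPerfect,
    JordanTKK.udHat_isCovering.isUniversalCentralExtension (JordanTKK.uceOfUTKK k J)
      JordanTKK.u_uceOfUTKK,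
    JordanTKK.udHat_isCovering, JordanTKK.uiderOfStar k J, JordanTKK.uceEquivUTKK k J,
    JordanTKK.uiderOfStar_starMk, JordanTKK.uiderOfStar_injective,
    JordanTKK.udHat_uceEquivUTKK, JordanTKK.uceEquivUTKK_mk, JordanTKK.image_HC,
    JordanTKK.ker_udHat, JordanTKK.image_ker_u⟩
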